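/- Let $p$ be a prime number and let $x, y, z$ be nonzero pairwise coprime integers. If $p$ exactly divides $(x-y)(y-z)(z-x)$, that is, $p \mid (x-y)(y-z)(z-x)$ but $p^2 \nmid (x-y)(y-z)(z-x)$, then $x^p + y^p + z^p \neq 0$. -/

import Mathlib

/-!
Up to symmetry `x = y + p m` with `p ∤ m`. Suppose `x ^ p + y ^ p + z ^ p = 0` with `p` odd. Then
`p` divides none of `x, y, z`, so in the ring of integers of `ℚ(ζ)`, `ζ` a primitive `p`-th root of
unity, the ideal `(x + ζ y)` is a `p`-th power `I ^ p` (`exists_span_eq_pow`).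

The `ω`-part of the class group (`ω` the Teichmüller character) is trivial, and this can be made
explicit with Jacobi sums. For a prime `P` modulo which `ζ` is a rational integer, the Jacobi sum
`J(χ, χ ^ j)` of the `p`-th power residue symbol modulo `P` generates the product of the conjugates
`σ_{t⁻¹} P` over the `t` such that the residues of `t` and `j t` add up to more than `p`
(`exists_span_eq_prod_map`). Averaging over `j` shows that `n = ∑ t⁻¹`, taken over this set, is
prime to `p` for some `j` (`exists_sum_carrySet_ne_zero`). For this `j` the product `A` of the
conjugates `σ_{t⁻¹} (x + ζ y)` is therefore `u * γ ^ p` with `u` a unit.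

Now divide by the complex conjugate. The unit `u` contributes a root of unity `(-ζ) ^ r`
(`exists_unit_eq_neg_zeta_pow_mul`), and the quotient of `γ ^ p` by its conjugate is `1` modulo
`(ζ - 1) ^ (p + 1)` (`zeta_sub_one_pow_dvd_pow_sub_pow`), an ideal equal to `p (ζ - 1) ^ 2`. On the
other hand `x + ζ ^ e y = y (1 + ζ ^ e) + p m`, and a direct expansion (`dvd_prod_sub_prod`) shows
that `A` divided by its conjugate is `ζ ^ n (1 - p (ζ - 1) n m / (2 y))` to the same precision.
Comparing the two forces `p ∣ n m` (`false_of_prod_mul_conj_pow_eq`), a contradiction.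
-/

open NumberField Finset

/-! ### Carry sets modulo `p` -/

section Carry

variable {p : ℕ} [hp : Fact p.Prime]

/-- The residues `t` prime to `p` for which adding the least positive residues of `t` and `j t`
produces a carry past `p`. Their inverses index the Galois conjugates of a prime that divide the
Jacobi sum `J(χ, χ ^ j)`. -/
def carrySet (j : (ZMod p)ˣ) : Finset (ZMod p)ˣ :=
  {t | p < (t : ZMod p).val + ((j * t : (ZMod p)ˣ) : ZMod p).val}

lemma mem_carrySet {j t : (ZMod p)ˣ} :
    t ∈ carrySet j ↔ p < (t : ZMod p).val + ((j * t : (ZMod p)ˣ) : ZMod p).val := by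
  simp [carrySet]

lemma val_unit_pos (t : (ZMod p)ˣ) : 0 < (t : ZMod p).val :=
  Nat.pos_of_ne_zero fun h ↦ t.ne_zero ((ZMod.val_eq_zero _).mp h)

lemma val_neg_unit (t : (ZMod p)ˣ) : ((-t : (ZMod p)ˣ) : ZMod p).val = p - (t : ZMod p).val := by
  rw [Units.val_neg, ZMod.neg_val, if_neg t.ne_zero]

lemma card_val_gt (a : ℕ) (ha : 0 < a) (hap : a < p) :
    #{k : (ZMod p)ˣ | p < a + (k : ZMod p).val} = a - 1 := by
  have : a - 1 = #(Ioo (p - a) p) := by rw [Nat.card_Ioo]; omega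
  rw [this]
  refine card_bij (fun k _ ↦ (k : ZMod p).val) (fun k hk ↦ ?_) (fun k _ l _ h ↦ ?_) fun n hn ↦ ?_
  · have := (k : ZMod p).val_lt
    simp only [mem_filter, mem_univ, true_and] at hk
    simp only [mem_Ioo]; omega
  · exact Units.ext (ZMod.val_injective p h)
  · simp only [mem_Ioo] at hn
    have hv : (n : ZMod p).val = n := ZMod.val_cast_of_lt hn.2
    have h0 : (n : ZMod p) ≠ 0 := fun h ↦ by rw [h, ZMod.val_zero] at hv; omega
    refine ⟨Units.mk0 _ h0, ?_, by simpa using hv⟩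
    simp only [mem_filter, mem_univ, true_and, Units.val_mk0, hv]; omega

/-- Each `t` lies in `t - 1` of the sets `carrySet j` (with `t` its least positive residue), so the
sum is `∑ (t - 1) t⁻¹ = (p - 1) - ∑ t⁻¹`. -/
lemma sum_sum_carrySet (hp2 : p ≠ 2) :
    ∑ j : (ZMod p)ˣ, ∑ t ∈ carrySet j, ((t⁻¹ : (ZMod p)ˣ) : ZMod p) = -1 := by
  have h1 : ∀ t : (ZMod p)ˣ, #{j : (ZMod p)ˣ | t ∈ carrySet j} = (t : ZMod p).val - 1 := by
    intro t
    rw [← card_val_gt _ (val_unit_pos t) (ZMod.val_lt _)]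
    refine card_bij (fun j _ ↦ j * t) (fun j hj ↦ by
        simpa only [mem_filter, mem_univ, true_and, mem_carrySet] using hj) (by simp) fun k hk ↦
      ⟨k * t⁻¹, by
        simpa only [mem_filter, mem_univ, true_and, mem_carrySet, inv_mul_cancel_right] using hk, by simp⟩
  have h2 : ∑ t : (ZMod p)ˣ, ((t⁻¹ : (ZMod p)ˣ) : ZMod p) = 0 := by
    rw [← Equiv.sum_comp (Equiv.inv _)]
    have := FiniteField.sum_pow_units (ZMod p) 1
    rw [if_neg] at this
    · simpa using this
    · rw [ZMod.card, Nat.dvd_one]; have := hp.out.two_le; omega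
  calc _ = ∑ t : (ZMod p)ˣ, ∑ j with t ∈ carrySet j, ((t⁻¹ : (ZMod p)ˣ) : ZMod p) := by
        refine sum_comm' fun j t ↦ ?_
        simp only [mem_univ, true_and, mem_filter, and_true]
    _ = ∑ t : (ZMod p)ˣ, (1 - ((t⁻¹ : (ZMod p)ˣ) : ZMod p)) := by
        refine sum_congr rfl fun t _ ↦ ?_
        rw [sum_const, h1, nsmul_eq_mul, Nat.cast_sub (val_unit_pos t), ZMod.natCast_zmod_val,
          sub_mul, Nat.cast_one, one_mul, Units.mul_inv]
    _ = -1 := by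
        rw [sum_sub_distrib, h2, sum_const, card_univ, ZMod.card_units_eq_totient,
          Nat.totient_prime hp.out, nsmul_eq_mul, Nat.cast_sub hp.out.one_le]
        simp

lemma exists_sum_carrySet_ne_zero (hp2 : p ≠ 2) :
    ∃ j : (ZMod p)ˣ, ∑ t ∈ carrySet j, ((t⁻¹ : (ZMod p)ˣ) : ZMod p) ≠ 0 := by
  by_contra! h
  have := sum_sum_carrySet hp2
  rw [sum_eq_zero fun j _ ↦ h j] at this
  exact neg_ne_zero.mpr one_ne_zero this.symm

lemma carrySet_neg_one : carrySet (-1 : (ZMod p)ˣ) = ∅ := by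
  ext t
  have := (t : ZMod p).val_lt
  simp only [mem_carrySet, neg_mul, one_mul, val_neg_unit, notMem_empty, iff_false]
  omega

/-- Exactly one of `t` and `-t` lies in `carrySet j`, since `t + j t ≠ 0`. -/
lemma two_mul_card_carrySet {j : (ZMod p)ˣ} (hj : j ≠ -1) : 2 * #(carrySet j) = p - 1 := by
  have h : (univ.filter fun t : (ZMod p)ˣ ↦ ¬ t ∈ carrySet j) =
      (carrySet j).map (Equiv.neg _).toEmbedding := by
    ext t
    have h1 := (t : ZMod p).val_lt
    have h2 := ((j * t : (ZMod p)ˣ) : ZMod p).val_lt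
    have h3 : (t : ZMod p).val + ((j * t : (ZMod p)ˣ) : ZMod p).val ≠ p := by
      intro h
      apply hj
      have := congrArg (Nat.cast : ℕ → ZMod p) h
      rw [Nat.cast_add, ZMod.natCast_zmod_val, ZMod.natCast_zmod_val, ZMod.natCast_self] at this
      have h4 : j * t = -t := Units.ext (by
        rw [Units.val_neg]; exact eq_neg_of_add_eq_zero_right this)
      exact mul_right_cancel (h4.trans (by simp))
    simp only [mem_filter, mem_univ, true_and, mem_map_equiv, Equiv.neg_symm, Equiv.neg_apply,
      mem_carrySet, mul_neg, val_neg_unit]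
    omega
  have h5 := card_filter_add_card_filter_not (s := (univ : Finset (ZMod p)ˣ)) (· ∈ carrySet j)
  rw [h, card_map, card_univ, ZMod.card_units_eq_totient, Nat.totient_prime hp.out] at h5
  simp only [filter_mem_eq_inter, univ_inter] at h5
  omega

end Carry

/-! ### Congruences modulo powers of `ζ - 1` -/

section Local

variable {p : ℕ} [hp : Fact p.Prime] {K : Type*} [Field K] [NumberField K]
  [IsCyclotomicExtension {p} ℚ K] {ζ : 𝓞 K}

lemma prime_zeta_sub_one (hζ : IsPrimitiveRoot ζ p) : Prime (ζ - 1) := by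
  have h : IsPrimitiveRoot (ζ : K) p := hζ.map_of_injective RingOfIntegers.coe_injective
  exact h.zeta_sub_one_prime'

lemma zeta_sub_one_dvd_p (hζ : IsPrimitiveRoot ζ p) : ζ - 1 ∣ (p : 𝓞 K) := by
  have h : IsPrimitiveRoot (ζ : K) p := hζ.map_of_injective RingOfIntegers.coe_injective
  exact_mod_cast h.toInteger_sub_one_dvd_prime'

lemma associated_zeta_sub_one_pow (hζ : IsPrimitiveRoot ζ p) :
    Associated ((ζ - 1) ^ (p - 1)) (p : 𝓞 K) := by
  have h : IsPrimitiveRoot (ζ : K) p := hζ.map_of_injective RingOfIntegers.coe_injective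
  have hc : IsCyclotomicExtension {p ^ (0 + 1)} ℚ K := by simpa
  have h' : IsPrimitiveRoot (ζ : K) (p ^ (0 + 1)) := by simpa using h
  have := IsCyclotomicExtension.Rat.map_eq_span_zeta_sub_one_pow p 0 h'
  rw [IsCyclotomicExtension.Rat.finrank p K, Nat.totient_prime hp.out, Ideal.map_span,
    Set.image_singleton, Ideal.span_singleton_pow, Ideal.span_singleton_eq_span_singleton] at this
  exact (by simpa using this : Associated (p : 𝓞 K) _).symm

lemma p_dvd_of_zeta_sub_one_dvd (hζ : IsPrimitiveRoot ζ p) {k : ℤ} (h : ζ - 1 ∣ (k : 𝓞 K)) :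
    (p : ℤ) ∣ k := by
  by_contra hk
  obtain ⟨u, v, huv⟩ := (Nat.prime_iff_prime_int.mp hp.out).irreducible.coprime_iff_not_dvd.mpr hk
  apply (prime_zeta_sub_one hζ).not_dvd_one
  have : (u * p + v * k : 𝓞 K) = 1 := by exact_mod_cast huv
  have h' := dvd_add ((zeta_sub_one_dvd_p hζ).mul_left (u : 𝓞 K)) (h.mul_left (v : 𝓞 K))
  rwa [this] at h'

lemma exists_int_dvd_sub (hζ : IsPrimitiveRoot ζ p) (x : 𝓞 K) : ∃ n : ℤ, ζ - 1 ∣ x - n := by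
  have h : IsPrimitiveRoot (ζ : K) p := hζ.map_of_injective RingOfIntegers.coe_injective
  have htop := h.integralPowerBasis.adjoin_gen_eq_top
  rw [h.integralPowerBasis_gen] at htop
  have hx : x ∈ Algebra.adjoin ℤ {h.toInteger} := htop ▸ Algebra.mem_top
  induction hx using Algebra.adjoin_induction with
  | mem x hx => exact ⟨1, by rw [Set.mem_singleton_iff.mp hx]; simp⟩
  | algebraMap r => exact ⟨r, by simp⟩
  | add x y _ _ hx hy =>
    obtain ⟨a, ha⟩ := hx
    obtain ⟨b, hb⟩ := hy
    exact ⟨a + b, by push_cast; convert dvd_add ha hb using 1; ring⟩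
  | mul x y _ _ hx hy =>
    obtain ⟨a, ha⟩ := hx
    obtain ⟨b, hb⟩ := hy
    exact ⟨a * b, by push_cast; convert dvd_add (ha.mul_right y) (hb.mul_left a) using 1; ring⟩

omit [IsCyclotomicExtension {p} ℚ K] [NumberField K] in
lemma zeta_sub_one_dvd_geom (i : ℕ) : ζ - 1 ∣ (∑ k ∈ range i, ζ ^ k) - i := by
  have : (∑ k ∈ range i, ζ ^ k) - (i : 𝓞 K) = ∑ k ∈ range i, (ζ ^ k - 1) := by simp
  rw [this]
  exact dvd_sum fun k _ ↦ sub_one_dvd_pow_sub_one ζ k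

/-- In the factorization `a ^ p - b ^ p = ∏ (a - ζ ^ i * b)` every factor is divisible by `ζ - 1`, and
the one for which `i` is the residue of `(a - b) / ((ζ - 1) b)` is divisible by its square. -/
lemma zeta_sub_one_pow_dvd_pow_sub_pow (hζ : IsPrimitiveRoot ζ p) {a b : 𝓞 K} (h : ζ - 1 ∣ a - b)
    (hb : ¬ ζ - 1 ∣ b) : (ζ - 1) ^ (p + 1) ∣ a ^ p - b ^ p := by
  classical
  obtain ⟨d, hd⟩ := h
  obtain ⟨d', hd'⟩ := exists_int_dvd_sub hζ d
  obtain ⟨b', hb'⟩ := exists_int_dvd_sub hζ b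
  have hpb : ¬ (p : ℤ) ∣ b' := fun h ↦ hb (by
    have h1 : ζ - 1 ∣ (b' : 𝓞 K) := (zeta_sub_one_dvd_p hζ).trans
      (by exact_mod_cast Int.cast_dvd_cast (α := 𝓞 K) _ _ h)
    simpa using dvd_add hb' h1)
  obtain ⟨u, v, huv⟩ := (Nat.prime_iff_prime_int.mp hp.out).irreducible.coprime_iff_not_dvd.mpr hpb
  obtain ⟨i, hi⟩ : ∃ i : ℕ, (p : ℤ) ∣ d' - i * b' := by
    refine ⟨((d' * v) % p).toNat, ?_⟩
    rw [Int.toNat_of_nonneg (Int.emod_nonneg _ (by exact_mod_cast hp.out.ne_zero))]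
    have := Int.emod_add_mul_ediv (d' * v) p
    rw [← eq_sub_iff_add_eq] at this
    rw [this]
    exact ⟨d' * u + d' * v / p * b', by linear_combination (-d') * huv⟩
  have hi' : ζ - 1 ∣ ((d' - i * b' : ℤ) : 𝓞 K) :=
    (zeta_sub_one_dvd_p hζ).trans (by exact_mod_cast Int.cast_dvd_cast (α := 𝓞 K) _ _ hi)
  have hmem : ζ ^ i ∈ Polynomial.nthRootsFinset p (1 : 𝓞 K) := by
    rw [Polynomial.mem_nthRootsFinset hp.out.pos, ← pow_mul, mul_comm, pow_mul, hζ.pow_eq_one, one_pow]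
  rw [hζ.pow_sub_pow_eq_prod_sub_mul a b hp.out.pos, ← mul_prod_erase _ _ hmem]
  have h1 : (ζ - 1) ^ 2 ∣ a - ζ ^ i * b := by
    have e : a - ζ ^ i * b = (ζ - 1) * (d - (∑ k ∈ range i, ζ ^ k) * b) := by
      have := mul_geom_sum ζ i
      linear_combination hd + b * this
    rw [e, pow_two]
    refine mul_dvd_mul_left _ ?_
    have h2 := zeta_sub_one_dvd_geom (ζ := ζ) i
    convert dvd_sub (dvd_add hd' hi') (dvd_add (h2.mul_right b) (hb'.mul_left (i : 𝓞 K))) using 1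
    push_cast; ring
  have h2 : (ζ - 1) ^ (p - 1) ∣
      ∏ μ ∈ (Polynomial.nthRootsFinset p (1 : 𝓞 K)).erase (ζ ^ i), (a - μ * b) := by
    have hc : #((Polynomial.nthRootsFinset p (1 : 𝓞 K)).erase (ζ ^ i)) = p - 1 := by
      rw [card_erase_of_mem hmem, hζ.card_nthRootsFinset]
    rw [← hc, ← prod_const]
    refine prod_dvd_prod_of_dvd _ _ fun μ hμ ↦ ?_
    obtain ⟨k, -, rfl⟩ := hζ.eq_pow_of_pow_eq_one
      ((Polynomial.mem_nthRootsFinset hp.out.pos _).mp (mem_of_mem_erase hμ))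
    have : a - ζ ^ k * b = (ζ - 1) * d - (ζ ^ k - 1) * b := by linear_combination hd
    rw [this]
    exact dvd_sub (dvd_mul_right _ _) ((sub_one_dvd_pow_sub_one ζ k).mul_right _)
  convert mul_dvd_mul h1 h2 using 1
  rw [← pow_add]; congr 1; have := hp.out.two_le; omega

/-- Each pair of factors satisfies
`y (1 + ζ ^ e) + p m ≡ (1 - p (ζ - 1) c e) (y (1 + ζ ^ e) + p m ζ ^ e)` modulo `p (ζ - 1) ^ 2`, where
`c ≡ m / (2 y)`; the correction terms add up because `(p (ζ - 1)) ^ 2` vanishes. -/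
lemma dvd_prod_sub_prod (hζ : IsPrimitiveRoot ζ p) {y m c : ℤ} (hc : (p : ℤ) ∣ m - 2 * y * c)
    {ι : Type*} (T : Finset ι) (e : ι → ℕ) :
    (p : 𝓞 K) * (ζ - 1) ^ 2 ∣ (∏ t ∈ T, (y * (1 + ζ ^ e t) + p * m)) -
      (1 - p * (ζ - 1) * c * (∑ t ∈ T, e t : ℕ)) *
        ∏ t ∈ T, (y * (1 + ζ ^ e t) + p * m * ζ ^ e t) := by
  classical
  obtain ⟨q, hq⟩ := zeta_sub_one_dvd_p hζ
  obtain ⟨c', hc'⟩ : ζ - 1 ∣ ((m - 2 * y * c : ℤ) : 𝓞 K) :=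
    (zeta_sub_one_dvd_p hζ).trans (by exact_mod_cast Int.cast_dvd_cast (α := 𝓞 K) _ _ hc)
  push_cast at hc'
  induction T using Finset.induction_on with
  | empty => simp
  | insert s T hs ih =>
    rw [prod_insert hs, prod_insert hs, sum_insert hs]
    obtain ⟨w, hw⟩ := ih
    obtain ⟨g, hg⟩ := zeta_sub_one_dvd_geom (ζ := ζ) (e s)
    have hgs := mul_geom_sum ζ (e s)
    set a := ∏ t ∈ T, (y * (1 + ζ ^ e t) + p * m : 𝓞 K)
    set b := ∏ t ∈ T, (y * (1 + ζ ^ e t) + p * m * ζ ^ e t : 𝓞 K)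
    set N := ((∑ t ∈ T, e t : ℕ) : 𝓞 K)
    set G := ∑ k ∈ range (e s), ζ ^ k
    have hz : ζ ^ e s = 1 + (ζ - 1) * G := by linear_combination -hgs
    have hG : G = e s + (ζ - 1) * g := by linear_combination hg
    -- the congruence for a single factor
    have h1 : ∃ w', (y * (1 + ζ ^ e s) + p * m : 𝓞 K) -
        (1 - p * (ζ - 1) * c * e s) * (y * (1 + ζ ^ e s) + p * m * ζ ^ e s) =
          p * (ζ - 1) ^ 2 * w' := by
      refine ⟨- m * g - e s * c' + c * e s * y * G + c * e s * q * m * ζ ^ e s, ?_⟩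
      rw [show (p : 𝓞 K) * (ζ - 1) ^ 2 *
          (- m * g - e s * c' + c * e s * y * G + c * e s * q * m * ζ ^ e s)
        = (ζ - 1) * p * (- m * ((ζ - 1) * g) - e s * ((ζ - 1) * c') + c * e s * y * ((ζ - 1) * G)
          + c * e s * ((ζ - 1) * q) * m * ζ ^ e s) by ring, ← hq, ← hc', hz]
      linear_combination ((p : 𝓞 K) * m * (ζ - 1)) * (-hG)
    obtain ⟨w', hw'⟩ := h1
    refine ⟨(y * (1 + ζ ^ e s) + p * m) * w + (1 - p * (ζ - 1) * c * N) * b * w'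
      + p * c ^ 2 * N * e s * b * (y * (1 + ζ ^ e s) + p * m * ζ ^ e s), ?_⟩
    rw [Nat.cast_add]
    linear_combination (y * (1 + ζ ^ e s) + p * m : 𝓞 K) * hw + (1 - p * (ζ - 1) * c * N) * b * hw'

/-- The local contradiction. Since `g ^ p ≡ h ^ p` modulo `p (ζ - 1) ^ 2`, the equation reduces to
`(1 - p (ζ - 1) c n) ζ ^ n ≡ (-ζ) ^ r` with `n = ∑ e t` and `c ≡ m / (2 y)`. Looking modulo `ζ - 1`
and then `(ζ - 1) ^ 2` gives `(-ζ) ^ r = ζ ^ n`, so `p` divides `c n`. -/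
lemma false_of_prod_mul_conj_pow_eq (hζ : IsPrimitiveRoot ζ p) (hp2 : p ≠ 2) {y m : ℤ}
    (hy : ¬ (p : ℤ) ∣ y)
    (hm : ¬ (p : ℤ) ∣ m) {ι : Type*} (T : Finset ι) (e : ι → ℕ) (he : ¬ p ∣ ∑ t ∈ T, e t)
    {g h : 𝓞 K} (hgh : ζ - 1 ∣ g - h) (hh : ¬ ζ - 1 ∣ h) (r : ℕ)
    (heq : ζ ^ (∑ t ∈ T, e t) * (∏ t ∈ T, (y * (1 + ζ ^ e t) + p * m)) * h ^ p =
      (-ζ) ^ r * (∏ t ∈ T, (y * (1 + ζ ^ e t) + p * m * ζ ^ e t)) * g ^ p) : False := by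
  have hprime := prime_zeta_sub_one hζ
  have hpp := Nat.prime_iff_prime_int.mp hp.out
  have hlp := zeta_sub_one_dvd_p hζ
  have hass := associated_zeta_sub_one_pow hζ
  have hp3 : 3 ≤ p := by have := hp.out.two_le; omega
  have h2 : ¬ (p : ℤ) ∣ 2 := fun h ↦ by
    have := Int.le_of_dvd (by norm_num) h
    omega
  -- choose `c` with `2 y c ≡ m` modulo `p`
  obtain ⟨c, hc⟩ : ∃ c : ℤ, (p : ℤ) ∣ m - 2 * y * c := by
    have : ¬ (p : ℤ) ∣ 2 * y := hpp.not_dvd_mul h2 hy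
    obtain ⟨u, v, huv⟩ := hpp.irreducible.coprime_iff_not_dvd.mpr this
    exact ⟨m * v, m * u, by linear_combination -m * huv⟩
  have hcp : ¬ (p : ℤ) ∣ c := fun h ↦ hm ((dvd_sub_left (h.mul_left _)).mp hc)
  have hprod := dvd_prod_sub_prod hζ hc T e
  set n := ∑ t ∈ T, e t
  set a := ∏ t ∈ T, (y * (1 + ζ ^ e t) + p * m : 𝓞 K)
  set b := ∏ t ∈ T, (y * (1 + ζ ^ e t) + p * m * ζ ^ e t : 𝓞 K) with hb
  have hpow : ∀ k : ℕ, ζ - 1 ∣ ζ ^ k - 1 := sub_one_dvd_pow_sub_one ζ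
  have hζu : IsUnit ζ := hζ.isUnit hp.out.ne_zero
  have hbl : ¬ ζ - 1 ∣ b := by
    rw [hb, hprime.dvd_finsetProd_iff]
    rintro ⟨t, -, ht⟩
    refine hpp.not_dvd_mul h2 hy (p_dvd_of_zeta_sub_one_dvd hζ ?_)
    push_cast
    convert dvd_sub ht (dvd_add ((hpow (e t)).mul_left (y : 𝓞 K))
      (hlp.mul_right (m * ζ ^ e t))) using 1
    ring
  have hM : (p : 𝓞 K) * (ζ - 1) ^ 2 ∣ (ζ - 1) ^ (p + 1) := by
    rw [show p + 1 = (p - 1) + 2 by omega, pow_add]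
    exact mul_dvd_mul_right hass.symm.dvd _
  have hM' : (ζ - 1) ^ (p + 1) ∣ (p : 𝓞 K) * (ζ - 1) ^ 2 := by
    rw [show p + 1 = (p - 1) + 2 by omega, pow_add]
    exact mul_dvd_mul_right hass.dvd _
  have hgp := hM.trans (zeta_sub_one_pow_dvd_pow_sub_pow hζ hgh hh)
  set X : 𝓞 K := (1 - p * (ζ - 1) * c * n) * ζ ^ n - (-ζ) ^ r with hX
  have hX1 : (ζ - 1) ^ (p + 1) ∣ X := by
    refine hprime.pow_dvd_of_dvd_mul_left (p + 1)
      (hprime.not_dvd_mul hbl fun h ↦ hh (hprime.dvd_of_dvd_pow h))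
      (hM'.trans (?_ : _ ∣ (b * h ^ p) * X))
    convert dvd_sub (hgp.mul_left ((-ζ) ^ r * b)) (hprod.mul_left (ζ ^ n * h ^ p)) using 1
    rw [hX]
    linear_combination heq
  have hl2 : (ζ - 1) ^ 2 ∣ (p : 𝓞 K) * (ζ - 1) := by
    rw [pow_two]; exact mul_dvd_mul_right hlp _
  have hlX : ζ - 1 ∣ X := (dvd_pow_self _ (by omega)).trans hX1
  have hr : Even r := by
    by_contra hr
    rw [Nat.not_even_iff_odd] at hr
    rw [hr.neg_pow] at hX
    refine h2 (p_dvd_of_zeta_sub_one_dvd hζ ?_)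
    have h3 : ζ - 1 ∣ (p : 𝓞 K) * (ζ - 1) * c * n * ζ ^ n :=
      (((dvd_mul_left _ _).mul_right _).mul_right _).mul_right _
    convert dvd_add (dvd_sub (dvd_sub hlX (hpow n)) (hpow r)) h3 using 1
    rw [hX]; push_cast; ring
  rw [hr.neg_pow] at hX
  -- write `ζ ^ r = ζ ^ n * ζ ^ d`
  obtain ⟨d, hd⟩ : ∃ d, ζ ^ r = ζ ^ n * ζ ^ d := by
    refine ⟨r + n * (p - 1), ?_⟩
    rw [← pow_add, show n + (r + n * (p - 1)) = r + p * n by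
      obtain ⟨k, rfl⟩ := Nat.exists_eq_add_of_le hp3
      simp only [show 3 + k - 1 = k + 2 by omega]
      ring, pow_add, pow_mul, hζ.pow_eq_one, one_pow, mul_one]
  have hX2 : X = ζ ^ n * (-(p * (ζ - 1) * (c * n : ℤ)) - (ζ ^ d - 1)) := by
    rw [hX, hd]; push_cast; ring
  rw [hX2, (hζu.pow n).dvd_mul_left] at hX1
  by_cases hpd : p ∣ d
  · obtain ⟨d, rfl⟩ := hpd
    rw [pow_mul, hζ.pow_eq_one, one_pow, sub_self, sub_zero, dvd_neg] at hX1
    have h4 : (ζ - 1) ^ (p - 1) * (ζ - 1) * (ζ - 1) ∣ p * (ζ - 1) * (c * n : ℤ) := by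
      convert hX1 using 1
      rw [← pow_succ, ← pow_succ]; congr 1; omega
    obtain ⟨u, hu⟩ := hass
    rw [← hu, show (ζ - 1) ^ (p - 1) * u * (ζ - 1) * ((c * n : ℤ) : 𝓞 K) =
      (ζ - 1) ^ (p - 1) * (ζ - 1) * (u * ((c * n : ℤ) : 𝓞 K)) by ring,
      mul_dvd_mul_iff_left (mul_ne_zero (pow_ne_zero _ hprime.ne_zero) hprime.ne_zero),
      u.isUnit.dvd_mul_left] at h4
    exact hpp.not_dvd_mul hcp (by exact_mod_cast he) (p_dvd_of_zeta_sub_one_dvd hζ h4)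
  · have h5 : (ζ - 1) ^ 2 ∣ ζ ^ d - 1 := by
      have := (pow_dvd_pow (ζ - 1) (show 2 ≤ p + 1 by omega)).trans hX1
      convert dvd_sub ((hl2.mul_right ((c * n : ℤ) : 𝓞 K)).neg_right) this using 1
      ring
    have h6 := h5.trans (hζ.associated_sub_one_pow_sub_one_of_coprime
      (((Nat.Prime.coprime_iff_not_dvd hp.out).mpr hpd).symm)).symm.dvd
    rw [pow_two] at h6
    have h7 : (ζ - 1) * (ζ - 1) ∣ (ζ - 1) * 1 := by simpa using h6
    exact hprime.not_dvd_one ((mul_dvd_mul_iff_left hprime.ne_zero).mp h7)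

end Local

/-! ### Characters of order `p` on a finite field -/

section FiniteField

variable {F : Type*} [Field F] [Fintype F]

lemma sum_pow_mul_one_sub_pow_eq_zero {a b : ℕ} (h : a + b < Fintype.card F - 1) :
    ∑ x : F, x ^ a * (1 - x) ^ b = 0 := by
  have h1 : ∀ x : F, x ^ a * (1 - x) ^ b =
      ∑ k ∈ range (b + 1), ((-1) ^ k * (b.choose k : F)) * x ^ (a + k) := by
    intro x
    rw [sub_eq_neg_add, add_pow, mul_sum]
    refine sum_congr rfl fun k _ ↦ ?_
    rw [neg_pow, one_pow, pow_add]; ring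
  simp_rw [h1]
  rw [sum_comm]
  refine sum_eq_zero fun k hk ↦ ?_
  rw [mem_range] at hk
  rw [← mul_sum, FiniteField.sum_pow_lt_card_sub_one F _ (by omega), mul_zero]

variable {p : ℕ} [hp : Fact p.Prime] {R : Type*} [CommRing R] [IsDomain R] {ζ : R}

omit [IsDomain R] in
/-- The character of order `p` that lifts `x ↦ x ^ (-(q - 1) / p)`, the exponent being written
`n * (p - 1)` with `q - 1 = n * p`. -/
lemma exists_mulChar_reduction (hζ : IsPrimitiveRoot ζ p) (φ : R →+* F)
    (hF : IsPrimitiveRoot (φ ζ) p) {n : ℕ} (hn : n * p = Fintype.card F - 1) :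
    ∃ χ : MulChar F R, χ ^ p = 1 ∧ χ ≠ 1 ∧ ∀ x, φ (χ x) = x ^ (n * (p - 1)) := by
  classical
  have hp2 := hp.out.two_le
  have hn0 : n ≠ 0 := by
    rintro rfl
    have := Fintype.one_lt_card (α := F)
    omega
  have hcard : Fintype.card Fˣ = n * p := by rw [Fintype.card_units, hn]
  obtain ⟨g, hg⟩ := IsCyclic.exists_generator (α := Fˣ)
  obtain ⟨k, -, hk⟩ := hF.eq_pow_of_pow_eq_one (ξ := ((g ^ (n * (p - 1)) : Fˣ) : F)) (by
    rw [← Units.val_pow_eq_pow_val, ← pow_mul, show n * (p - 1) * p = n * p * (p - 1) by ring,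
      ← hcard, pow_mul, pow_card_eq_one, one_pow, Units.val_one])
  set μ : Rˣ := (hζ.isUnit hp.out.ne_zero).unit ^ k
  have hμp : μ ^ p = 1 := by
    ext
    simp only [μ, Units.val_pow_eq_pow_val, IsUnit.unit_spec, Units.val_one]
    rw [← pow_mul, mul_comm, pow_mul, hζ.pow_eq_one, one_pow]
  have hμ : μ ∈ rootsOfUnity (Fintype.card Fˣ) R := by
    rw [mem_rootsOfUnity, hcard, mul_comm, pow_mul, hμp, one_pow]
  have hgen : ∀ x : Fˣ, ∃ i : ℕ, x = g ^ i := fun x ↦ by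
    have := hg x
    rw [← mem_powers_iff_mem_zpowers] at this
    obtain ⟨i, hi⟩ := this
    exact ⟨i, hi.symm⟩
  have hχ : ∀ i : ℕ, MulChar.ofRootOfUnity hμ hg ((g ^ i : Fˣ) : F) = (μ : R) ^ i := fun i ↦ by
    rw [Units.val_pow_eq_pow_val, map_pow, MulChar.ofRootOfUnity_spec]
  have hφ : ∀ x, φ (MulChar.ofRootOfUnity hμ hg x) = x ^ (n * (p - 1)) := by
    intro x
    rcases eq_or_ne x 0 with rfl | hx
    · rw [MulChar.map_zero, map_zero, zero_pow (mul_ne_zero hn0 (by omega))]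
    · obtain ⟨i, hi⟩ := hgen (Units.mk0 x hx)
      have hx' : x = ((g ^ i : Fˣ) : F) := by rw [← hi, Units.val_mk0]
      rw [hx', hχ, map_pow]
      have : φ (μ : R) = ((g ^ (n * (p - 1)) : Fˣ) : F) := by
        rw [← hk]; simp [μ]
      rw [this, ← Units.val_pow_eq_pow_val, ← Units.val_pow_eq_pow_val, ← pow_mul, ← pow_mul,
        mul_comm]
  refine ⟨MulChar.ofRootOfUnity hμ hg, ?_, fun h ↦ ?_, hφ⟩
  · ext x
    obtain ⟨i, rfl⟩ := hgen x
    rw [MulChar.pow_apply_coe, hχ, MulChar.one_apply_coe, ← pow_mul, mul_comm, pow_mul,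
      ← Units.val_pow_eq_pow_val, hμp, Units.val_one, one_pow]
  · have : ∀ x : Fˣ, x ^ (n * (p - 1)) = 1 := fun x ↦ by
      ext
      rw [Units.val_pow_eq_pow_val, ← hφ, h, MulChar.one_apply_coe, map_one, Units.val_one]
    rw [FiniteField.forall_pow_eq_one_iff, ← hn, mul_dvd_mul_iff_left hn0] at this
    exact Nat.not_dvd_of_pos_of_lt (by omega) (by omega) this

omit [IsDomain R] hp in
/-- The exponent `n * (p - 1) * a` is reduced below `q - 1 = n * p`, so that degrees can be compared. -/
lemma reduction_pow {χ : MulChar F R} (φ : R →+* F) {n : ℕ} (hn : n * p = Fintype.card F - 1)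
    (hφ : ∀ x, φ (χ x) = x ^ (n * (p - 1))) {a : ℕ} (ha : 0 < a) (hap : a < p) (x : F) :
    φ ((χ ^ a) x) = x ^ (n * (p - a)) := by
  rw [MulChar.pow_apply' _ ha.ne', map_pow, hφ, ← pow_mul]
  rcases eq_or_ne x 0 with rfl | hx
  · have hn0 : n ≠ 0 := by
      rintro rfl
      have := Fintype.one_lt_card (α := F)
      omega
    rw [zero_pow, zero_pow]
    · exact mul_ne_zero hn0 (by omega)
    · exact mul_ne_zero (mul_ne_zero hn0 (by omega)) (by omega)
  · have h : n * (p - 1) * a = n * (p - a) + n * p * (a - 1) := by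
      obtain ⟨b, rfl⟩ := Nat.exists_eq_add_of_le' ha
      obtain ⟨c, rfl⟩ := Nat.exists_eq_add_of_le hap.le
      simp only [show b + 1 + c - 1 = b + c by omega, show b + 1 + c - (b + 1) = c by omega,
        show b + 1 - 1 = b by omega]
      ring
    rw [h, pow_add, pow_mul x (n * p), hn, FiniteField.pow_card_sub_one_eq_one x hx, one_pow,
      mul_one]

end FiniteField

/-! ### The Galois action on the ring of integers -/

section Galois

variable {p : ℕ} [hp : Fact p.Prime] {K : Type*} [Field K] [NumberField K]
  [IsCyclotomicExtension {p} ℚ K]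

variable (K) in
/-- The automorphism of the ring of integers of the `p`-th cyclotomic field that sends each `p`-th
root of unity to its `t`-th power. -/
noncomputable def galConj (t : (ZMod p)ˣ) : 𝓞 K ≃+* 𝓞 K :=
  MulSemiringAction.toRingEquiv _ (𝓞 K) ((IsCyclotomicExtension.Rat.galEquivZMod p K).symm t)

lemma galConj_apply_of_pow_eq_one (t : (ZMod p)ˣ) {x : 𝓞 K} (hx : x ^ p = 1) :
    galConj K t x = x ^ (t : ZMod p).val := by
  change (IsCyclotomicExtension.Rat.galEquivZMod p K).symm t • x = _
  rw [IsCyclotomicExtension.Rat.galEquivZMod_smul_of_pow_eq p K _ hx, MulEquiv.apply_symm_apply]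

lemma galConj_mul_apply (s t : (ZMod p)ˣ) (x : 𝓞 K) :
    galConj K (s * t) x = galConj K s (galConj K t x) := by
  change (IsCyclotomicExtension.Rat.galEquivZMod p K).symm (s * t) • x = _
  rw [map_mul, mul_smul]
  rfl

lemma galConj_one_apply (x : 𝓞 K) : galConj K (1 : (ZMod p)ˣ) x = x := by
  change (IsCyclotomicExtension.Rat.galEquivZMod p K).symm 1 • x = _
  rw [map_one, one_smul]

lemma map_galConj_inv (t : (ZMod p)ˣ) (I : Ideal (𝓞 K)) :
    I.map (galConj K t⁻¹) = I.comap (galConj K t) := by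
  have : galConj K t⁻¹ = (galConj K t).symm := by
    ext1 x
    apply (galConj K t).injective
    rw [← galConj_mul_apply, mul_inv_cancel, galConj_one_apply, RingEquiv.apply_symm_apply]
  rw [this]
  exact Ideal.map_symm _

omit [IsCyclotomicExtension {p} ℚ K] hp in
lemma absNorm_map_ringEquiv (σ : 𝓞 K ≃+* 𝓞 K) (I : Ideal (𝓞 K)) :
    Ideal.absNorm (I.map σ) = Ideal.absNorm I := by
  rw [Ideal.absNorm_apply, Ideal.absNorm_apply, Submodule.cardQuot_apply, Submodule.cardQuot_apply]
  exact (Nat.card_congr (Ideal.quotientEquiv I (I.map σ) σ rfl).toEquiv).symm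

end Galois

/-! ### Prime factorization of a Jacobi sum -/

section Jacobi

variable {p : ℕ} [hp : Fact p.Prime] {K : Type*} [Field K] [NumberField K]
  [IsCyclotomicExtension {p} ℚ K] {ζ : 𝓞 K} {F : Type*} [Field F] [Fintype F]

omit [Fintype F] in
lemma ringHomComp_galConj {χ : MulChar F (𝓞 K)} (hχ : χ ^ p = 1) (t : (ZMod p)ˣ) :
    χ.ringHomComp (galConj K t : 𝓞 K →+* 𝓞 K) = χ ^ (t : ZMod p).val := by
  ext1 x
  rw [MulChar.ringHomComp_apply, MulChar.pow_apply_coe]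
  refine galConj_apply_of_pow_eq_one (K := K) t ?_
  rw [← MulChar.pow_apply_coe, hχ, MulChar.one_apply_coe]

lemma galConj_jacobiSum {χ : MulChar F (𝓞 K)} (hχ : χ ^ p = 1) (j t : (ZMod p)ˣ) :
    galConj K t (jacobiSum χ (χ ^ (j : ZMod p).val)) =
      jacobiSum (χ ^ (t : ZMod p).val) (χ ^ ((j * t : (ZMod p)ˣ) : ZMod p).val) := by
  have h := jacobiSum_ringHomComp χ (χ ^ (j : ZMod p).val) (galConj K t : 𝓞 K →+* 𝓞 K)
  rw [RingHom.coe_coe] at h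
  rw [← h, ringHomComp_galConj hχ, ringHomComp_galConj, ← pow_mul, Units.val_mul, ZMod.val_mul,
    ← pow_eq_pow_mod _ hχ]
  rw [← pow_mul, mul_comm, pow_mul, hχ, one_pow]

/-- The conjugate reduces to `∑ x ^ A * (1 - x) ^ B` with `A + B < q - 1`, and the carry condition is
exactly this inequality. -/
lemma map_galConj_jacobiSum_eq_zero {χ : MulChar F (𝓞 K)} (hχ : χ ^ p = 1) {φ : 𝓞 K →+* F}
    {n : ℕ} (hn : n * p = Fintype.card F - 1) (hφ : ∀ x, φ (χ x) = x ^ (n * (p - 1)))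
    {j t : (ZMod p)ˣ} (ht : t ∈ carrySet j) :
    φ (galConj K t (jacobiSum χ (χ ^ (j : ZMod p).val))) = 0 := by
  rw [mem_carrySet] at ht
  have h1 := (t : ZMod p).val_lt
  have h2 := ((j * t : (ZMod p)ˣ) : ZMod p).val_lt
  have h3 := val_unit_pos t
  have h4 := val_unit_pos (j * t)
  rw [galConj_jacobiSum hχ, jacobiSum, map_sum]
  simp_rw [map_mul, reduction_pow φ hn hφ h3 h1, reduction_pow φ hn hφ h4 h2]
  refine sum_pow_mul_one_sub_pow_eq_zero ?_
  have hn0 : 0 < n := Nat.pos_of_ne_zero <| by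
    rintro rfl
    have := Fintype.one_lt_card (α := F)
    omega
  rw [← hn, ← mul_add]
  exact Nat.mul_lt_mul_of_pos_left (by omega) hn0

lemma jacobiSum_mul_conj {χ : MulChar F (𝓞 K)} (hχ : χ ^ p = 1) (hχ1 : χ ≠ 1) {j : (ZMod p)ˣ}
    (hj : j ≠ -1) :
    jacobiSum χ (χ ^ (j : ZMod p).val) *
        galConj K (-1 : (ZMod p)ˣ) (jacobiSum χ (χ ^ (j : ZMod p).val)) =
      Fintype.card F := by
  have hord : orderOf χ = p := orderOf_eq_prime hχ hχ1
  have hinv : ∀ k : (ZMod p)ˣ, χ ^ ((-k : (ZMod p)ˣ) : ZMod p).val = (χ ^ (k : ZMod p).val)⁻¹ := by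
    intro k
    rw [eq_inv_iff_mul_eq_one, ← pow_add, val_neg_unit, Nat.sub_add_cancel (ZMod.val_lt _).le, hχ]
  have h1 : χ ^ ((-1 : (ZMod p)ˣ) : ZMod p).val = χ⁻¹ := by
    rw [hinv, Units.val_one, ZMod.val_one, pow_one]
  rw [galConj_jacobiSum hχ, h1, mul_neg, mul_one, hinv]
  apply RingOfIntegers.coe_injective
  have hinj := RingOfIntegers.coe_injective (K := K)
  rw [map_mul, ← jacobiSum_ringHomComp, ← jacobiSum_ringHomComp, ← MulChar.ringHomComp_inv,
    ← MulChar.ringHomComp_inv, jacobiSum_mul_jacobiSum_inv, map_natCast]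
  · rw [ringChar.eq_zero]
    exact (CharP.ringChar_ne_zero_of_finite F).symm
  · exact (MulChar.ringHomComp_ne_one_iff hinj).mpr hχ1
  · refine (MulChar.ringHomComp_ne_one_iff hinj).mpr fun h ↦ ?_
    have := orderOf_dvd_of_pow_eq_one h
    rw [hord] at this
    exact Nat.not_dvd_of_pos_of_lt (val_unit_pos j) (ZMod.val_lt _) this
  · rw [← MulChar.ringHomComp_mul]
    refine (MulChar.ringHomComp_ne_one_iff hinj).mpr fun h ↦ hj ?_
    rw [← pow_succ'] at h
    have := orderOf_dvd_of_pow_eq_one h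
    rw [hord, ← ZMod.natCast_eq_zero_iff, Nat.cast_add, ZMod.natCast_zmod_val, Nat.cast_one] at this
    ext
    rw [Units.val_neg, Units.val_one]
    exact eq_neg_of_add_eq_zero_left this

/-- Stickelberger's relation for one Jacobi sum, for a prime modulo which `ζ` is a rational integer:
the Jacobi sum is divisible by the conjugates indexed by the carry set, these are distinct, and the
norms agree because `J` times its complex conjugate is `q`. -/
theorem exists_span_eq_prod_map (hζ : IsPrimitiveRoot ζ p) {j : (ZMod p)ˣ}
    (hj : j ≠ -1) {φ : 𝓞 K →+* F} (hφ : Function.Surjective φ) (hF : IsPrimitiveRoot (φ ζ) p)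
    {a : ℤ} (ha : φ ζ = a) :
    ∃ J : 𝓞 K, Ideal.span {J} = ∏ t ∈ carrySet j, (RingHom.ker φ).map (galConj K t⁻¹) := by
  classical
  obtain ⟨n, hn⟩ : p ∣ Fintype.card F - 1 := by
    have h := hF.isUnit hp.out.ne_zero
    have : orderOf h.unit = p := by
      rw [← orderOf_units, IsUnit.unit_spec, ← hF.eq_orderOf]
    rw [← Fintype.card_units, ← this]
    exact orderOf_dvd_card
  rw [mul_comm] at hn
  obtain ⟨χ, hχ, hχ1, hφχ⟩ := exists_mulChar_reduction hζ φ hF hn.symm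
  set J := jacobiSum χ (χ ^ (j : ZMod p).val)
  have hnorm : J * galConj K (-1 : (ZMod p)ˣ) J = Fintype.card F := jacobiSum_mul_conj hχ hχ1 hj
  refine ⟨J, ?_⟩
  set P := RingHom.ker φ
  set q := Fintype.card F
  have hPq : Ideal.absNorm P = q := by
    rw [Ideal.absNorm_apply, Submodule.cardQuot_apply, Nat.card_congr
      (RingHom.quotientKerEquivOfSurjective hφ).toEquiv, Nat.card_eq_fintype_card]
  have hker : ∀ t : (ZMod p)ˣ, P.map (galConj K t⁻¹) =
      RingHom.ker (φ.comp (galConj K t : 𝓞 K →+* 𝓞 K)) := by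
    intro t
    rw [map_galConj_inv]
    rfl
  have hmax : ∀ t : (ZMod p)ˣ, (P.map (galConj K t⁻¹)).IsMaximal := by
    intro t
    rw [hker]
    exact RingHom.ker_isMaximal_of_surjective _ (hφ.comp (galConj K t).surjective)
  have hdvd : ∏ t ∈ carrySet j, P.map (galConj K t⁻¹) ∣ Ideal.span {J} := by
    refine Finset.prod_dvd_of_coprime (fun s _ t _ hst ↦ ?_) fun t ht ↦ ?_
    · have := hmax s
      have := hmax t
      refine Ideal.isCoprime_of_isMaximal fun h ↦ hst ?_
      -- `ζ ^ s⁻¹ - a` lies in the conjugate of `P` by `s⁻¹`, and in no other one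
      have h1 : ∀ u : (ZMod p)ˣ, galConj K u (galConj K s⁻¹ ζ - a) =
          ζ ^ ((u * s⁻¹ : (ZMod p)ˣ) : ZMod p).val - a := fun u ↦ by
        rw [map_sub, ← galConj_mul_apply, map_intCast, galConj_apply_of_pow_eq_one (K := K) _ hζ.pow_eq_one]
      have h2 : galConj K s⁻¹ ζ - a ∈ P.map (galConj K s⁻¹) := by
        rw [hker, RingHom.mem_ker, RingHom.comp_apply, RingHom.coe_coe, h1, mul_inv_cancel,
          Units.val_one, ZMod.val_one, pow_one, map_sub, ha, map_intCast, sub_self]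
      simp only at h
      rw [h, hker, RingHom.mem_ker, RingHom.comp_apply, RingHom.coe_coe, h1, map_sub, map_intCast,
        map_pow, ← ha, sub_eq_zero] at h2
      have h3 := hF.pow_inj (ZMod.val_lt _) hp.out.one_lt (h2.trans (pow_one _).symm)
      have h4 : (t * s⁻¹ : (ZMod p)ˣ) = 1 := Units.ext (ZMod.val_injective p (by
        rw [h3, Units.val_one, ZMod.val_one]))
      exact (mul_inv_eq_one.mp h4).symm
    · rw [Ideal.dvd_span_singleton, hker, RingHom.mem_ker]
      exact map_galConj_jacobiSum_eq_zero hχ hn.symm hφχ ht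
  have hN1 : Ideal.absNorm (∏ t ∈ carrySet j, P.map (galConj K t⁻¹)) = q ^ #(carrySet j) := by
    rw [map_prod, prod_congr rfl fun t _ ↦ absNorm_map_ringEquiv (galConj K t⁻¹) P, prod_const, hPq]
  have hN2 : Ideal.absNorm (Ideal.span {J}) = q ^ #(carrySet j) := by
    have h := congrArg (fun x ↦ Ideal.absNorm (Ideal.span {x})) hnorm
    rw [← Ideal.span_singleton_mul_span_singleton, map_mul] at h
    have h' : Ideal.span {galConj K (-1 : (ZMod p)ˣ) J} =
        (Ideal.span {J}).map (galConj K (-1 : (ZMod p)ˣ)) := by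
      rw [Ideal.map_span, Set.image_singleton]
    rw [h', absNorm_map_ringEquiv, ← pow_two, Ideal.absNorm_span_natCast, RingOfIntegers.rank,
      IsCyclotomicExtension.Rat.finrank p K, Nat.totient_prime hp.out, ← two_mul_card_carrySet hj,
      mul_comm, pow_mul] at h
    exact Nat.pow_left_injective two_ne_zero h
  obtain ⟨E, hE⟩ := hdvd
  have hq0 : 0 < q ^ #(carrySet j) := pow_pos Fintype.card_pos _
  rw [hE, map_mul, hN1, Nat.mul_eq_left hq0.ne', Ideal.absNorm_eq_one_iff] at hN2
  rw [hE, hN2, Ideal.mul_top]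

end Jacobi

/-! ### Units modulo their complex conjugates -/

section Unit

variable {p : ℕ} [hp : Fact p.Prime] {K : Type*} [Field K] [NumberField K]
  [IsCyclotomicExtension {p} ℚ K] {ζ : 𝓞 K}

lemma complexConj_eq_galConj [IsCMField K] (hζ : IsPrimitiveRoot ζ p) (x : 𝓞 K) :
    IsCMField.complexConj K x = galConj K (-1 : (ZMod p)ˣ) x := by
  have hK : IsPrimitiveRoot (ζ : K) p := hζ.map_of_injective RingOfIntegers.coe_injective
  set τ : Gal(K/ℚ) := (IsCMField.complexConj K).restrictScalars ℚ with hτ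
  have hτζ : τ (ζ : K) = (ζ : K)⁻¹ := by
    have hu : (hζ.isUnit hp.out.ne_zero).unit ∈ Units.torsion K :=
      (CommGroup.mem_torsion _).mpr (isOfFinOrder_iff_pow_eq_one.mpr
        ⟨p, hp.out.pos, Units.ext (by simpa using hζ.pow_eq_one)⟩)
    exact IsCMField.complexConj_torsion K ⟨_, hu⟩
  have hτ1 : IsCyclotomicExtension.Rat.galEquivZMod p K τ = -1 := by
    refine Units.ext (ZMod.val_injective p (hK.pow_inj (ZMod.val_lt _) (ZMod.val_lt _) ?_))
    rw [← IsCyclotomicExtension.Rat.galEquivZMod_apply_of_pow_eq p K τ hK.pow_eq_one, hτζ,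
      val_neg_unit, Units.val_one, ZMod.val_one]
    refine (eq_inv_of_mul_eq_one_left ?_).symm
    rw [← pow_succ, Nat.sub_add_cancel hp.out.one_le, hK.pow_eq_one]
  have : τ = (IsCyclotomicExtension.Rat.galEquivZMod p K).symm (-1) := by
    rw [← hτ1, MulEquiv.symm_apply_apply]
  change τ x = _
  rw [this]
  rfl

/-- Kronecker's theorem for cyclotomic units: `u` divided by its complex conjugate is a root of
unity. -/
lemma exists_unit_eq_neg_zeta_pow_mul (hζ : IsPrimitiveRoot ζ p) (hp2 : p ≠ 2) (u : (𝓞 K)ˣ) :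
    ∃ r : ℕ, (u : 𝓞 K) = (-ζ) ^ r * galConj K (-1 : (ZMod p)ˣ) u := by
  have hp3 : 2 < p := by have := hp.out.two_le; omega
  have hK : IsPrimitiveRoot (ζ : K) p := hζ.map_of_injective RingOfIntegers.coe_injective
  have := IsCyclotomicExtension.Rat.isCMField K (S := {p}) ⟨p, rfl, hp3⟩
  set w := IsCMField.unitsMulComplexConjInv K u with hw
  have hfin : IsOfFinOrder ((w : (𝓞 K)ˣ) : K) := by
    have h := (CommGroup.mem_torsion _).mp w.2
    obtain ⟨k, hk, hk'⟩ := isOfFinOrder_iff_pow_eq_one.mp h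
    refine isOfFinOrder_iff_pow_eq_one.mpr ⟨k, hk, ?_⟩
    have := congrArg (fun v : (𝓞 K)ˣ ↦ (v : K)) hk'
    simpa using this
  obtain ⟨r, hr⟩ := hK.exists_neg_pow_of_isOfFinOrder (hp.out.odd_of_ne_two hp2) hfin
  refine ⟨r, RingOfIntegers.coe_injective ?_⟩
  have h1 : (w : (𝓞 K)ˣ) * IsCMField.unitsComplexConj K u = u := by
    rw [hw, IsCMField.unitsMulComplexConjInv_apply, inv_mul_cancel_right]
  have h2 := congrArg (fun v : (𝓞 K)ˣ ↦ (v : K)) h1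
  simp only [Units.coe_mul, hr] at h2
  rw [map_mul, ← h2, map_pow, map_neg]
  exact congrArg _ (complexConj_eq_galConj hζ u)

end Unit

/-! ### The factor `x + ζ y` of a sum of two `p`-th powers -/

section Descent

variable {p : ℕ} [hp : Fact p.Prime] {K : Type*} [Field K] [NumberField K]
  [IsCyclotomicExtension {p} ℚ K] {ζ : 𝓞 K}

/-- The factorization obtained for prime ideals extends multiplicatively. -/
lemma exists_span_eq_prod_map_of_prime_factors (S : Finset (ZMod p)ˣ)
    (I : Ideal (𝓞 K)) (hI : I ≠ 0)
    (h : ∀ P : Ideal (𝓞 K), Prime P → P ∣ I →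
      ∃ γ : 𝓞 K, Ideal.span {γ} = ∏ t ∈ S, P.map (galConj K t⁻¹)) :
    ∃ γ : 𝓞 K, Ideal.span {γ} = ∏ t ∈ S, I.map (galConj K t⁻¹) := by
  induction I using UniqueFactorizationMonoid.induction_on_prime with
  | h₁ => exact absurd rfl hI
  | h₂ I hu =>
    rw [Ideal.isUnit_iff] at hu
    refine ⟨1, ?_⟩
    rw [hu, Ideal.span_singleton_one]
    simp_rw [Ideal.map_top]
    simp only [← Ideal.one_eq_top, prod_const_one]
  | h₃ I P hI' hP ih =>
    obtain ⟨γ, hγ⟩ := ih hI' fun Q hQ hQI ↦ h Q hQ (hQI.mul_left P)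
    obtain ⟨δ, hδ⟩ := h P hP (dvd_mul_right P I)
    refine ⟨δ * γ, ?_⟩
    simp_rw [← Ideal.span_singleton_mul_span_singleton, hγ, hδ, Ideal.map_mul, prod_mul_distrib]

variable {x y z : ℤ}

omit [IsCyclotomicExtension {p} ℚ K] in
lemma root_factor_dvd (hp2 : p ≠ 2) (h : x ^ p + y ^ p + z ^ p = 0) {μ : 𝓞 K} (hμ : μ ^ p = 1) :
    (x + μ * y : 𝓞 K) ∣ (z : 𝓞 K) ^ p := by
  have hodd := hp.out.odd_of_ne_two hp2
  have h1 : (x + μ * y : 𝓞 K) ∣ x ^ p + (μ * y) ^ p := hodd.add_dvd_pow_add_pow _ _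
  have h2 : (x : 𝓞 K) ^ p + y ^ p + z ^ p = 0 := by exact_mod_cast congrArg (Int.cast : ℤ → 𝓞 K) h
  rw [mul_pow, hμ, one_mul] at h1
  rw [show (z : 𝓞 K) ^ p = -(x ^ p + y ^ p) by linear_combination h2]
  exact h1.neg_right

omit [IsCyclotomicExtension {p} ℚ K] [NumberField K] in
lemma not_mem_of_isCoprime {P : Ideal (𝓞 K)} (hP : P.IsPrime) {a b : ℤ} (hab : IsCoprime a b)
    (ha : (a : 𝓞 K) ∈ P) : (b : 𝓞 K) ∉ P := by
  intro hb
  obtain ⟨u, v, huv⟩ := hab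
  refine hP.ne_top ((Ideal.eq_top_iff_one P).mpr ?_)
  have := congrArg (Int.cast : ℤ → 𝓞 K) huv
  push_cast at this
  rw [← this]
  exact P.add_mem (P.mul_mem_left _ ha) (P.mul_mem_left _ hb)

omit [IsCyclotomicExtension {p} ℚ K] in
lemma mem_of_root_factor_mem (hp2 : p ≠ 2) (h : x ^ p + y ^ p + z ^ p = 0) {μ : 𝓞 K}
    (hμ : μ ^ p = 1) {P : Ideal (𝓞 K)} (hP : P.IsPrime) (hm : (x + μ * y : 𝓞 K) ∈ P) :
    (z : 𝓞 K) ∈ P :=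
  hP.mem_of_pow_mem p (P.mem_of_dvd (root_factor_dvd hp2 h hμ) hm)

lemma zeta_sub_one_notMem (hζ : IsPrimitiveRoot ζ p) (hpz : ¬ (p : ℤ) ∣ z) {P : Ideal (𝓞 K)}
    (hP : P.IsPrime) (hz : (z : 𝓞 K) ∈ P) : ζ - 1 ∉ P := fun h ↦
  not_mem_of_isCoprime hP
    ((Nat.prime_iff_prime_int.mp hp.out).irreducible.coprime_iff_not_dvd.mpr hpz).symm hz
    (by exact_mod_cast P.mem_of_dvd (zeta_sub_one_dvd_p hζ) h)

/-- When `p` does not divide `z`, the ideals `(x + μ y)` for the `p`-th roots of unity `μ` are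
pairwise coprime with product `(z) ^ p`. -/
lemma exists_span_eq_pow (hζ : IsPrimitiveRoot ζ p) (hp2 : p ≠ 2) (h : x ^ p + y ^ p + z ^ p = 0)
    (hyz : IsCoprime y z) (hpz : ¬ (p : ℤ) ∣ z) :
    ∃ I : Ideal (𝓞 K), Ideal.span {(x + ζ * y : 𝓞 K)} = I ^ p := by
  classical
  have hodd := hp.out.odd_of_ne_two hp2
  have hprod : ∏ μ ∈ Polynomial.nthRootsFinset p (1 : 𝓞 K), Ideal.span {(x + μ * y : 𝓞 K)} =
      Ideal.span {(-z : 𝓞 K)} ^ p := by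
    rw [Ideal.prod_span_singleton, Ideal.span_singleton_pow,
      ← hζ.pow_add_pow_eq_prod_add_mul _ _ hodd, hodd.neg_pow]
    have h2 : (x : 𝓞 K) ^ p + y ^ p + z ^ p = 0 := by
      exact_mod_cast congrArg (Int.cast : ℤ → 𝓞 K) h
    rw [show (x : 𝓞 K) ^ p + y ^ p = -z ^ p by linear_combination h2]
  refine Finset.exists_eq_pow_of_mul_eq_pow_of_coprime (fun μ hμ ν hν hμν ↦ ?_) hprod ζ
    ((Polynomial.mem_nthRootsFinset hp.out.pos _).mpr hζ.pow_eq_one)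
  rw [Polynomial.mem_nthRootsFinset hp.out.pos] at hμ hν
  rw [Ideal.isCoprime_iff_sup_eq]
  by_contra htop
  obtain ⟨M, hM, hle⟩ := Ideal.exists_le_maximal _ htop
  have h1 : (x + μ * y : 𝓞 K) ∈ M := hle (Ideal.mem_sup_left (Ideal.mem_span_singleton_self _))
  have h2 : (x + ν * y : 𝓞 K) ∈ M := hle (Ideal.mem_sup_right (Ideal.mem_span_singleton_self _))
  have hz := mem_of_root_factor_mem hp2 h hμ hM.isPrime h1
  have hy := not_mem_of_isCoprime hM.isPrime hyz.symm hz
  have h3 : (μ - ν) * (y : 𝓞 K) ∈ M := by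
    convert M.sub_mem h1 h2 using 1; ring
  have h4 := (hM.isPrime.mem_or_mem h3).resolve_right hy
  refine zeta_sub_one_notMem hζ hpz hM.isPrime hz (M.mem_of_dvd ?_ h4)
  -- `μ - ν` is a unit times `η - 1` with `η` a primitive `p`-th root of unity
  obtain ⟨i, hi, rfl⟩ := hζ.eq_pow_of_pow_eq_one hμ
  obtain ⟨k, hk, rfl⟩ := hζ.eq_pow_of_pow_eq_one hν
  have key : ∀ i k : ℕ, i < k → k < p → ζ ^ k - ζ ^ i ∣ ζ - 1 := by
    intro i k hik hk
    have hco : (k - i).Coprime p := by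
      refine ((Nat.Prime.coprime_iff_not_dvd hp.out).mpr ?_).symm
      exact Nat.not_dvd_of_pos_of_lt (by omega) (by omega)
    have : ζ ^ k - ζ ^ i = ζ ^ i * (ζ ^ (k - i) - 1) := by
      rw [mul_sub, ← pow_add, Nat.add_sub_cancel' hik.le, mul_one]
    rw [this, ((hζ.isUnit hp.out.ne_zero).pow i).mul_left_dvd]
    exact (hζ.associated_sub_one_pow_sub_one_of_coprime hco).symm.dvd
  rcases lt_trichotomy i k with hik | rfl | hik
  · rw [← neg_sub, neg_dvd]
    exact key i k hik hk
  · exact absurd rfl hμν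
  · exact key k i hik hi

/-- Modulo a prime factor of `x + ζ y` the root of unity `ζ` is congruent to the rational integer
`-x / y`, so Stickelberger's relation applies. -/
lemma exists_span_eq_prod_map_of_dvd (hζ : IsPrimitiveRoot ζ p) (hp2 : p ≠ 2)
    (h : x ^ p + y ^ p + z ^ p = 0) (hyz : IsCoprime y z) (hpz : ¬ (p : ℤ) ∣ z)
    {j : (ZMod p)ˣ} (hj : j ≠ -1) {P : Ideal (𝓞 K)} (hP : Prime P)
    (hdvd : P ∣ Ideal.span {(x + ζ * y : 𝓞 K)}) :
    ∃ γ : 𝓞 K, Ideal.span {γ} = ∏ t ∈ carrySet j, P.map (galConj K t⁻¹) := by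
  have hPp := Ideal.isPrime_of_prime hP
  have hPm : P.IsMaximal := hPp.isMaximal hP.ne_zero
  rw [Ideal.dvd_span_singleton] at hdvd
  have hz := mem_of_root_factor_mem hp2 h hζ.pow_eq_one hPp hdvd
  let _ := Ideal.Quotient.field P
  have : Finite (𝓞 K ⧸ P) := Ideal.finiteQuotientOfFreeOfNeBot P hP.ne_zero
  let _ := Fintype.ofFinite (𝓞 K ⧸ P)
  have hne : Ideal.Quotient.mk P ζ ≠ 1 := fun he ↦ by
    refine zeta_sub_one_notMem hζ hpz hPp hz ?_
    rw [← Ideal.Quotient.eq_zero_iff_mem, map_sub, he, map_one, sub_self]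
  have hF : IsPrimitiveRoot (Ideal.Quotient.mk P ζ) p := by
    have := orderOf_eq_prime (x := Ideal.Quotient.mk P ζ) (p := p)
      (by rw [← map_pow, hζ.pow_eq_one, map_one]) hne
    exact this ▸ IsPrimitiveRoot.orderOf _
  obtain ⟨u, v, huv⟩ := hyz
  have ha : Ideal.Quotient.mk P ζ = (-(u * x) : ℤ) := by
    rw [← map_intCast (Ideal.Quotient.mk P), Ideal.Quotient.eq]
    have h1 : (u * y + v * z : 𝓞 K) = 1 := by exact_mod_cast huv
    have h2 : ζ - ((-(u * x) : ℤ) : 𝓞 K) = u * (x + ζ * y) + ζ * v * z := by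
      push_cast
      linear_combination (-ζ) * h1
    rw [h2]
    exact P.add_mem (P.mul_mem_left _ hdvd) (P.mul_mem_left _ hz)
  have := exists_span_eq_prod_map hζ hj Ideal.Quotient.mk_surjective hF ha
  rwa [Ideal.mk_ker] at this

variable (K) in
include K in
/-- The case in which `x - y` is the factor that `p` divides exactly once. The field `K` is any
`p`-th cyclotomic field. -/
theorem pow_add_pow_add_pow_ne_zero (hp2 : p ≠ 2) {x y z : ℤ} (hz : z ≠ 0)
    (hyz : IsCoprime y z) (h1 : (p : ℤ) ∣ x - y) (h2 : ¬ (p : ℤ) ^ 2 ∣ x - y) :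
    x ^ p + y ^ p + z ^ p ≠ 0 := by
  intro h
  have hpp := Nat.prime_iff_prime_int.mp hp.out
  have hp3 : 3 ≤ p := by have := hp.out.two_le; omega
  have htwo : ¬ (p : ℤ) ∣ 2 := fun h ↦ by
    have := Int.le_of_dvd (by norm_num) h
    omega
  obtain ⟨m, hm⟩ := h1
  have hpm : ¬ (p : ℤ) ∣ m := fun ⟨k, hk⟩ ↦ h2 ⟨k, by rw [hm, hk]; ring⟩
  have hxy : x = y + p * m := by linear_combination hm
  have hboth : ¬ ((p : ℤ) ∣ y ∧ (p : ℤ) ∣ z) := fun ⟨hy, hz⟩ ↦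
    hpp.not_isUnit (hyz.isUnit_of_dvd' hy hz)
  have hdiff : (p : ℤ) ∣ x ^ p - y ^ p := (Dvd.intro _ hm.symm).trans (sub_dvd_pow_sub_pow x y p)
  have hpz : ¬ (p : ℤ) ∣ z := fun hz ↦ hboth ⟨by
    have h3 : (p : ℤ) ∣ 2 * y ^ p := by
      have h4 := (dvd_add hdiff (dvd_pow hz hp.out.ne_zero)).neg_right
      rwa [show -(x ^ p - y ^ p + z ^ p) = 2 * y ^ p by linear_combination -h] at h4
    exact hpp.dvd_of_dvd_pow ((hpp.dvd_or_dvd h3).resolve_left htwo), hz⟩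
  have hpy : ¬ (p : ℤ) ∣ y := fun hy ↦ hpz (hpp.dvd_of_dvd_pow (n := p) (by
    have h4 := (dvd_add hdiff ((dvd_pow hy hp.out.ne_zero).mul_left 2)).neg_right
    rwa [show -(x ^ p - y ^ p + 2 * y ^ p) = z ^ p by linear_combination -h] at h4))
  obtain ⟨ζ, hζ⟩ : ∃ ζ : 𝓞 K, IsPrimitiveRoot ζ p :=
    ⟨_, (IsCyclotomicExtension.zeta_spec p ℚ K).toInteger_isPrimitiveRoot⟩
  obtain ⟨j, hjsum⟩ := exists_sum_carrySet_ne_zero hp2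
  have hj : j ≠ -1 := by
    rintro rfl
    rw [carrySet_neg_one] at hjsum
    exact hjsum sum_empty
  obtain ⟨I, hI⟩ := exists_span_eq_pow hζ hp2 h hyz hpz
  have hα : (x + ζ * y : 𝓞 K) ≠ 0 := by
    intro h0
    have := root_factor_dvd hp2 h hζ.pow_eq_one
    rw [h0, zero_dvd_iff] at this
    exact hz (by exact_mod_cast pow_eq_zero_iff (hp.out.ne_zero) |>.mp this)
  have hI0 : I ≠ 0 := by
    rintro rfl
    rw [zero_pow hp.out.ne_zero, Ideal.zero_eq_bot, Ideal.span_singleton_eq_bot] at hI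
    exact hα hI
  obtain ⟨γ, hγ⟩ := exists_span_eq_prod_map_of_prime_factors (carrySet j) I hI0 fun P hP hPI ↦
    exists_span_eq_prod_map_of_dvd hζ hp2 h hyz hpz hj hP
      (hI ▸ hPI.trans (dvd_pow_self I hp.out.ne_zero))
  set S := carrySet j
  set e : (ZMod p)ˣ → ℕ := fun t ↦ ((t⁻¹ : (ZMod p)ˣ) : ZMod p).val
  set c := galConj K (-1 : (ZMod p)ˣ)
  set A : 𝓞 K := ∏ t ∈ S, (y * (1 + ζ ^ e t) + p * m) with hA
  set B : 𝓞 K := ∏ t ∈ S, (y * (1 + ζ ^ e t) + p * m * ζ ^ e t) with hB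
  have hxy' : (x : 𝓞 K) = y + p * m := by exact_mod_cast congrArg (Int.cast : ℤ → 𝓞 K) hxy
  have hfac : ∀ t : (ZMod p)ˣ, galConj K t⁻¹ (x + ζ * y) = y * (1 + ζ ^ e t) + p * m := by
    intro t
    rw [map_add, map_mul, map_intCast, map_intCast,
      galConj_apply_of_pow_eq_one (K := K) _ hζ.pow_eq_one, hxy']
    ring
  obtain ⟨u, hu⟩ : Associated (γ ^ p) A := by
    rw [← Ideal.span_singleton_eq_span_singleton, ← Ideal.span_singleton_pow, hγ, ← prod_pow, hA,
      ← Ideal.prod_span_singleton]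
    refine prod_congr rfl fun t _ ↦ ?_
    rw [← Ideal.map_pow, ← hI, Ideal.map_span, Set.image_singleton, hfac]
  have hcζ : ∀ k, ζ ^ k * c (ζ ^ k) = 1 := by
    intro k
    have : ζ * c ζ = 1 := by
      rw [galConj_apply_of_pow_eq_one (K := K) _ hζ.pow_eq_one, ← pow_succ', val_neg_unit,
        Units.val_one, ZMod.val_one, Nat.sub_add_cancel hp.out.one_le, hζ.pow_eq_one]
    rw [map_pow, ← mul_pow, this, one_pow]
  have hcA : ζ ^ (∑ t ∈ S, e t) * c A = B := by
    rw [← prod_pow_eq_pow_sum, hA, map_prod, ← prod_mul_distrib]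
    refine prod_congr rfl fun t _ ↦ ?_
    simp only [map_add, map_mul, map_one, map_intCast, map_natCast]
    linear_combination (y : 𝓞 K) * hcζ (e t)
  obtain ⟨r, hr⟩ := exists_unit_eq_neg_zeta_pow_mul hζ hp2 u
  have hcA' : c A = c γ ^ p * c u := by rw [← hu, map_mul, map_pow]
  have hprime := prime_zeta_sub_one hζ
  have hcl : ∀ w, ζ - 1 ∣ w → ζ - 1 ∣ c w := by
    rintro w ⟨v, rfl⟩
    rw [map_mul, map_sub, map_one, galConj_apply_of_pow_eq_one (K := K) _ hζ.pow_eq_one]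
    exact (sub_one_dvd_pow_sub_one ζ _).mul_right _
  have hcc : ∀ w, c (c w) = w := fun w ↦ by
    rw [← galConj_mul_apply, neg_mul_neg, one_mul, galConj_one_apply]
  have hconj : ζ - 1 ∣ γ - c γ := by
    obtain ⟨k, hk⟩ := exists_int_dvd_sub hζ γ
    have h3 := hcl _ hk
    rw [map_sub, map_intCast] at h3
    convert dvd_sub hk h3 using 1
    ring
  have hcγ : ¬ ζ - 1 ∣ c γ := by
    intro h3
    have h4 := hcl _ h3
    rw [hcc] at h4
    have h5 : ζ - 1 ∣ A := hu ▸ (dvd_pow h4 hp.out.ne_zero).mul_right _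
    rw [hA, hprime.dvd_finsetProd_iff] at h5
    obtain ⟨t, -, ht⟩ := h5
    refine hpp.not_dvd_mul htwo hpy (p_dvd_of_zeta_sub_one_dvd hζ ?_)
    push_cast
    convert dvd_sub ht (dvd_add ((sub_one_dvd_pow_sub_one ζ (e t)).mul_left (y : 𝓞 K))
      ((zeta_sub_one_dvd_p hζ).mul_right (m : 𝓞 K))) using 1
    ring
  refine false_of_prod_mul_conj_pow_eq hζ hp2 hpy hpm S e (fun hdvd ↦ hjsum ?_) hconj hcγ r ?_
  · rw [← ZMod.natCast_eq_zero_iff, Nat.cast_sum] at hdvd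
    rw [← hdvd]
    exact sum_congr rfl fun t _ ↦ (ZMod.natCast_zmod_val _).symm
  · rw [← hA, ← hB, ← hcA, hcA', ← hu]
    linear_combination ζ ^ (∑ t ∈ S, e t) * γ ^ p * c γ ^ p * hr

end Descent

theorem theoremt110071 (p : ℕ) (hp : p.Prime) (x y z : ℤ)
    (hx : x ≠ 0) (hy : y ≠ 0) (hz : z ≠ 0)
    (hxy : IsCoprime x y) (hyz : IsCoprime y z) (hzx : IsCoprime z x)
    (hdvd : (p : ℤ) ∣ (x - y) * (y - z) * (z - x))
    (hexact : ¬ (p : ℤ) ^ 2 ∣ (x - y) * (y - z) * (z - x)) :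
    x ^ p + y ^ p + z ^ p ≠ 0 := by
  rcases eq_or_ne p 2 with rfl | hp2
  · positivity
  have : Fact p.Prime := ⟨hp⟩
  -- the results above use the canonical `ℚ`-algebra structure of a field of characteristic zero
  have : @IsCyclotomicExtension {p} ℚ (CyclotomicField p ℚ) _ _ DivisionRing.toRatAlgebra :=
    CyclotomicField.isCyclotomicExtension p ℚ
  have hpp := Nat.prime_iff_prime_int.mp hp
  rcases hpp.dvd_or_dvd hdvd with h | h
  · rcases hpp.dvd_or_dvd h with h | h
    · exact pow_add_pow_add_pow_ne_zero (CyclotomicField p ℚ) hp2 hz hyz h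
        fun h' ↦ hexact ((h'.mul_right _).mul_right _)
    · intro h0
      exact pow_add_pow_add_pow_ne_zero (CyclotomicField p ℚ) hp2 hx hzx h
        (fun h' ↦ hexact ((h'.mul_left _).mul_right _)) (by linear_combination h0)
  · intro h0
    exact pow_add_pow_add_pow_ne_zero (CyclotomicField p ℚ) hp2 hy hxy h
      (fun h' ↦ hexact (h'.mul_left _)) (by linear_combination h0)
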